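/- Let $p$ be a power of $2$ ($p\ge 2$), let $q$ be a power of $p$, and let $\mathbb F$ be an algebraic closure of $\mathbb F_q$. Let $e\ge 1$ and let $R(x)=\sum_{i=1}^e a_i x^{p^i}\in\mathbb F_q[x]$ with $a_e\neq 0$. For $x\in\mathbb F$ put $E(x)=R(x)+\sum_{i=1}^e (a_ix)^{p^{-i}}$, and assume that $V=\ker(E\colon\mathbb F\to\mathbb F)$ is contained in $\mathbb F_q$. For $a\in\mathbb F_q$ let $C_a$ be the affine curve $y^p-y=x(R(x)+ax)$, and set $$T_{R,0}=\{a\in\mathbb F_q : |C_a(\mathbb F_q)|=q\},$$ $$T_{R,\max}=\{a\in\mathbb F_q : |C_a(\mathbb F_q)|=q+(p-1)p^e\sqrt q\},\qquad T_{R,\min}=\{a\in\mathbb F_q : |C_a(\mathbb F_q)|=q-(p-1)p^e\sqrt q\}.$$ Let $b_0,\dots,b_e\in\mathbb F_q$, and for $x\in\mathbb F$ put $F^*(x)=\sum_{i=0}^e (b_ix)^{p^{-i}}$. Assume that $b_0b_e\ne 0$, that $F^*(1)=0$, that $W_F^*=\ker(F^*\colon\mathbb F\to\mathbb F)$ is contained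 in $\mathbb F_q$, and that $R=R_F$, where $$R_F(x)=\sum_{i=1}^e\Bigl(\sum_{j=0}^{e-i}(b_jb_{j+i})^{p^{-j}}\Bigr)x^{p^i}.$$ For $t\in\mathbb F_q$ put $$\alpha_F(t)=F^*(t)^2+\sum_{0\le i<j\le e}b_i^{p^{-i}}b_j^{p^{-j}}\in\mathbb F_q.$$ Let $\ell$ be an odd prime, let $W_2$ denote Witt vectors of length two (for the prime $2$), let $\xi_2\colon W_2(\mathbb F_2)\to\overline{\mathbb Q}_\ell^{\times}$ be a faithful character, and put $\sqrt{-1}=\xi_2(1,0)$. Let $\mathrm{Tr}_{q/2}\colon W_2(\mathbb F_q)\to W_2(\mathbb F_2)$ be the trace $(x,y)\mapsto\sum_{i=0}^{[\mathbb F_q:\mathbb F_2]-1}(x^{2^i},y^{2^i})$, and for $x\in\mathbb F_q$ put $Q_q(x)=\xi_2(\mathrm{Tr}_{q/2}(x,0))$ and $\psi_q(x)=\xi_2(\mathrm{Tr}_{q/2}(0,x))$. Define $$S_F=\{t\in\mathbb F_q : Q_q(v)=\psi_q(tv)\text{ for all }v\in W_F^*\},\qquad S_0=\mathbb F_q\setminus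 S_F,$$ $$S_{F,\pm}=\{t\in S_F : Q_q(t)=\pm(\sqrt{-1})^{[\mathbb F_q:\mathbb F_2]/2}\}.$$ Then $[\mathbb F_q:\mathbb F_2]$ is even (so that $S_{F,\pm}$ make sense), and: (i) $\mathbb F_q$ is the disjoint union $S_0\sqcup S_{F,-}\sqcup S_{F,+}$; (ii) $\alpha_F(S_0)\subset T_{R,0}$, $\alpha_F(S_{F,-})=T_{R,\max}$ and $\alpha_F(S_{F,+})=T_{R,\min}$. -/

import Mathlib

open scoped Polynomial

namespace VanDerGeerVlugt

noncomputable section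

/-! ### Witt vectors of length two over a finite field of characteristic two -/

/-- Witt vectors of length two (for the prime `2`). -/
abbrev W2 (A : Type*) := TruncatedWittVector 2 2 A

/-- The Witt vector `(x, y)`. -/
def W2.pair {A : Type*} (x y : A) : W2 A := TruncatedWittVector.mk 2 ![x, y]

/-- The additive map `W₂(A) → W₂(B)`, `(x, y) ↦ (f x, f y)`, induced by a ring homomorphism. -/
def W2.map {A B : Type*} [CommRing A] [CommRing B] (f : A →+* B) : W2 A →+ W2 B :=
  have key : ∀ X : WittVector 2 A,
      TruncatedWittVector.mk 2 (fun j => f ((WittVector.truncate 2 X).coeff j)) =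
        WittVector.truncate 2 (WittVector.map f X) := by
    intro X
    ext j
    simp [WittVector.map_coeff]
  { toFun := fun w => TruncatedWittVector.mk 2 (fun j => f (w.coeff j))
    map_zero' := by
      ext j
      simp
    map_add' := by
      intro x y
      obtain ⟨X, rfl⟩ := WittVector.truncate_surjective 2 2 A x
      obtain ⟨Y, rfl⟩ := WittVector.truncate_surjective 2 2 A y
      rw [← map_add, key, key, key, map_add, map_add] }

theorem W2.coeff_map {A B : Type*} [CommRing A] [CommRing B] (f : A →+* B) (w : W2 A)
    (j : Fin 2) : (W2.map f w).coeff j = f (w.coeff j) := by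
  simp [W2.map]

section Trace

variable {K : Type*} [Field K] [Finite K] [Algebra (ZMod 2) K] [CharP K 2]

/-- The sum of the conjugates `∑ (x^(2^i), y^(2^i))`, `0 ≤ i < [K : 𝔽₂]`, as an element
of `W₂(K)`. -/
def conjSum (w : W2 K) : W2 K :=
  ∑ i ∈ Finset.range (Module.finrank (ZMod 2) K), W2.map (iterateFrobenius K 2 i) w

/-- The sum of the conjugates lies in `W₂(𝔽₂)`. -/
theorem exists_map_eq_conjSum (w : W2 K) :
    ∃ v : W2 (ZMod 2), W2.map (algebraMap (ZMod 2) K) v = conjSum w := by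
  classical
  have hcard : ∀ x : K, x ^ 2 ^ Module.finrank (ZMod 2) K = x := by
    intro x
    have := Fintype.ofFinite K
    have h := FiniteField.pow_card x
    rwa [Module.card_eq_pow_finrank (K := ZMod 2) (V := K), ZMod.card] at h
  have hstep : ∀ i, W2.map (frobenius K 2) (W2.map (iterateFrobenius K 2 i) w) =
      W2.map (iterateFrobenius K 2 (i + 1)) w := by
    intro i
    ext j
    simp only [W2.coeff_map, frobenius_def, iterateFrobenius_def, pow_succ, pow_mul]
  have hend : W2.map (iterateFrobenius K 2 (Module.finrank (ZMod 2) K)) w =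
      W2.map (iterateFrobenius K 2 0) w := by
    ext j
    simp only [W2.coeff_map, iterateFrobenius_def, hcard, pow_zero, pow_one]
  have hfix : W2.map (frobenius K 2) (conjSum w) = conjSum w := by
    unfold conjSum
    rw [map_sum, Finset.sum_congr rfl (fun i _ => hstep i)]
    have h1 := Finset.sum_range_succ
      (fun i => W2.map (iterateFrobenius K 2 i) w) (Module.finrank (ZMod 2) K)
    have h2 := Finset.sum_range_succ'
      (fun i => W2.map (iterateFrobenius K 2 i) w) (Module.finrank (ZMod 2) K)
    rw [h1, hend] at h2
    exact (add_right_cancel h2).symm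
  have hc : ∀ j, ∃ z : ZMod 2, algebraMap (ZMod 2) K z = (conjSum w).coeff j := by
    intro j
    have h := congrArg (fun v => TruncatedWittVector.coeff j v) hfix
    simp only [W2.coeff_map, frobenius_def] at h
    have h' : (conjSum w).coeff j * ((conjSum w).coeff j - 1) = 0 := by
      linear_combination h
    rcases mul_eq_zero.mp h' with h0 | h1
    · exact ⟨0, by rw [map_zero, h0]⟩
    · exact ⟨1, by rw [map_one, sub_eq_zero.mp h1]⟩
  choose z hz using hc
  refine ⟨TruncatedWittVector.mk 2 z, ?_⟩
  ext j
  rw [W2.coeff_map, TruncatedWittVector.coeff_mk, hz]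

/-- The trace map `Tr_{q/2} : W₂(𝔽_q) → W₂(𝔽₂)`: the element of `W₂(𝔽₂)` whose image
in `W₂(𝔽_q)` is the sum of the conjugates. -/
def wittTrace (w : W2 K) : W2 (ZMod 2) := Classical.choose (exists_map_eq_conjSum w)

theorem map_wittTrace (w : W2 K) :
    W2.map (algebraMap (ZMod 2) K) (wittTrace w) = conjSum w :=
  Classical.choose_spec (exists_map_eq_conjSum w)

variable {M : Type*} [CommMonoid M]

/-- `Q_q(x) = ξ₂(Tr_{q/2}(x, 0))`. -/
def Q (ξ : AddChar (W2 (ZMod 2)) M) (x : K) : M := ξ (wittTrace (W2.pair x 0))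

/-- `ψ_q(x) = ξ₂(Tr_{q/2}(0, x))`. -/
def psi (ξ : AddChar (W2 (ZMod 2)) M) (x : K) : M := ξ (wittTrace (W2.pair 0 x))

end Trace

/-! ### Linearized polynomials, with `p = 2 ^ s` -/

/-- `x ^ (p ^ (-i))` for `p = 2 ^ s`, in a perfect ring of characteristic two. -/
def pRoot {L : Type*} [CommRing L] [ExpChar L 2] [PerfectRing L 2] (s i : ℕ) (x : L) : L :=
  (iterateFrobeniusEquiv L 2 (s * i)).symm x

section Linearized

variable {K : Type*} [Field K] (s e : ℕ)

/-- The polynomial `R(x) = ∑_{1 ≤ i ≤ e} aᵢ x^(p^i)`. -/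
def polyR (a : ℕ → K) : K[X] :=
  ∑ i ∈ Finset.Icc 1 e, Polynomial.C (a i) * Polynomial.X ^ ((2 ^ s) ^ i)

/-- The polynomial `F(x) = ∑_{0 ≤ i ≤ e} bᵢ x^(p^i)`. -/
def polyF (b : ℕ → K) : K[X] :=
  ∑ i ∈ Finset.range (e + 1), Polynomial.C (b i) * Polynomial.X ^ ((2 ^ s) ^ i)

variable (L : Type*) [Field L] [Algebra K L] [ExpChar L 2] [PerfectRing L 2]

/-- The map `E = R + R^* : L → L`, where `R^*(x) = ∑_{1 ≤ i ≤ e} (aᵢ x)^(p^(-i))`. -/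
def mapE (a : ℕ → K) (x : L) : L :=
  Polynomial.aeval x (polyR s e a) +
    ∑ i ∈ Finset.Icc 1 e, pRoot s i (algebraMap K L (a i) * x)

/-- The adjoint `F^* : L → L`, `F^*(x) = ∑_{0 ≤ i ≤ e} (bᵢ x)^(p^(-i))`. -/
def adjF (b : ℕ → K) (x : L) : L :=
  ∑ i ∈ Finset.range (e + 1), pRoot s i (algebraMap K L (b i) * x)

end Linearized

section Family

variable {K : Type*} [Field K] [Finite K] [CharP K 2] (s e : ℕ)

/-- `V = ker (R + R^*)` in the algebraic closure. -/
def kerE (a : ℕ → K) : Set (AlgebraicClosure K) :=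
  {x | mapE s e (AlgebraicClosure K) a x = 0}

/-- `W_F^* = ker F^*` in the algebraic closure. -/
def kerAdjF (b : ℕ → K) : Set (AlgebraicClosure K) :=
  {x | adjF s e (AlgebraicClosure K) b x = 0}

/-- The coefficients `∑_{0 ≤ j ≤ e - i} (bⱼ b_{j+i})^(p^(-j))` of `R_F`. -/
def coeffRF (b : ℕ → K) (i : ℕ) : K :=
  ∑ j ∈ Finset.range (e - i + 1), pRoot s j (b j * b (j + i))

/-- The polynomial `R_F`. -/
def polyRF (b : ℕ → K) : K[X] := polyR s e (coeffRF s e b)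

/-- `γ_F = ∑_{0 ≤ i < j ≤ e} bᵢ^(p^(-i)) bⱼ^(p^(-j))`. -/
def gammaF (b : ℕ → K) : K :=
  ∑ j ∈ Finset.range (e + 1), ∑ i ∈ Finset.range j, pRoot s i (b i) * pRoot s j (b j)

/-- `α_F(t) = γ_F + F^*(t)^2`. -/
def alphaF (b : ℕ → K) (t : K) : K := gammaF s e b + adjF s e K b t ^ 2

/-- The conditions on `F = ∑ bᵢ τ^i`: `b₀ b_e ≠ 0`, `F^*(1) = 0` and `W_F^* ⊆ 𝔽_q`. -/
structure IsAdmissible (b : ℕ → K) : Prop where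
  coeff_ne_zero : b 0 * b e ≠ 0
  adj_one : adjF s e (AlgebraicClosure K) b 1 = 0
  ker_subset : kerAdjF s e b ⊆ Set.range (algebraMap K (AlgebraicClosure K))

/-- The number of `𝔽_q`-points of the affine curve `y^p - y = x (R(x) + c x)`. -/
def numPoints (R : K[X]) (c : K) : ℕ :=
  Nat.card {P : K × K // P.2 ^ (2 ^ s) - P.2 = P.1 * (R.eval P.1 + c * P.1)}

/-- `T_{R,0}`: the twists with `q` points. -/
def T0 (R : K[X]) : Set K := {c | numPoints s R c = Nat.card K}

/-- `T_{R,max}`: the twists with `q + (p - 1) p^e √q` points. -/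
def Tmax (R : K[X]) : Set K :=
  {c | (numPoints s R c : ℝ) =
    (Nat.card K : ℝ) + ((2 : ℝ) ^ s - 1) * ((2 : ℝ) ^ s) ^ e * Real.sqrt (Nat.card K)}

/-- `T_{R,min}`: the twists with `q - (p - 1) p^e √q` points. -/
def Tmin (R : K[X]) : Set K :=
  {c | (numPoints s R c : ℝ) =
    (Nat.card K : ℝ) - ((2 : ℝ) ^ s - 1) * ((2 : ℝ) ^ s) ^ e * Real.sqrt (Nat.card K)}

variable [Algebra (ZMod 2) K] {C : Type*} [CommRing C] (ξ : AddChar (W2 (ZMod 2)) C)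

/-- `S_F = {t ∈ 𝔽_q | ∀ v ∈ W_F^*, Q_q(v) = ψ_q(t v)}`. -/
def SF (b : ℕ → K) : Set K :=
  {t | ∀ v : K, algebraMap K (AlgebraicClosure K) v ∈ kerAdjF s e b → Q ξ v = psi ξ (t * v)}

/-- `S_0 = 𝔽_q ∖ S_F`. -/
def S0 (b : ℕ → K) : Set K := (SF s e ξ b)ᶜ

/-- `S_{F,-} = {t ∈ S_F | Q_q(t) = -(√-1)^([𝔽_q : 𝔽₂]/2)}`, where `√-1 = ξ₂(1, 0)`. -/
def Sminus (b : ℕ → K) : Set K :=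
  {t | t ∈ SF s e ξ b ∧ Q ξ t = -ξ (W2.pair 1 0) ^ (Module.finrank (ZMod 2) K / 2)}

/-- `S_{F,+} = {t ∈ S_F | Q_q(t) = (√-1)^([𝔽_q : 𝔽₂]/2)}`, where `√-1 = ξ₂(1, 0)`. -/
def Splus (b : ℕ → K) : Set K :=
  {t | t ∈ SF s e ξ b ∧ Q ξ t = ξ (W2.pair 1 0) ^ (Module.finrank (ZMod 2) K / 2)}

end Family

end

end VanDerGeerVlugt

open VanDerGeerVlugt

/-! Counting points with additive characters gives `q + (p - 1) S(c)`, where `S(c)` is the sum over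
`x` of `psi (x (R x + c x))`. The function `Q` is a quadratic refinement of `psi`: `Q x * Q y = Q (x
+ y) * psi (x y)`. Both are Frobenius invariant, so the condition `F^*(1) = 0` turns `psi (x (R_F x
+ γ_F x))` into `Q (F x)` (`psi_mul_polyRF`). Since `F` and `F^*` are adjoint for `psi`, it follows
that `S(α_F(t))` is the sum of `Q (F x) * psi (t F x)`.

The image of `F` on `K` is the annihilator of `W = ker F^*`. Poisson summation over `W` and
completing the square therefore give `S(α_F(t)) * Q t = G * ∑ v ∈ W, Q v * psi (t v)`, with `G` the
sum of all `Q y` (`sum_psi_alphaF`). The factorization `F^* ∘ F = E` and `V ⊆ K` make `W` isotropic,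
so the inner summand is a character of `W`. Its sum is `|W| = p ^ e` if `t ∈ S_F` and `0` otherwise.
With `[K : 𝔽₂] = 2k` and `i = √-1`, `sum_Q` gives `G = -2 ^ k * i ^ k`, so the sign of `Q t = ± i ^
k` decides between maximum and minimum.

The equalities in (ii) also need every `a` with `S(a) ≠ 0` to be a value of `α_F`
(`exists_alphaF_eq`). -/

namespace VanDerGeerVlugt

/-! ### Addition of Witt vectors of length two -/

theorem wittAdd_one : (WittVector.wittAdd 2 1 : MvPolynomial (Fin 2 × ℕ) ℤ) =
    .X (0, 1) + .X (1, 1) - .X (0, 0) * .X (1, 0) := by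
  have h := wittStructureInt_prop 2 (MvPolynomial.X 0 + MvPolynomial.X 1 : MvPolynomial (Fin 2) ℤ) 1
  have h0 := WittVector.wittAdd_zero 2
  unfold WittVector.wittAdd at *
  simp only [wittPolynomial_one, map_add, map_mul, map_pow, MvPolynomial.bind₁_X_right,
    MvPolynomial.rename_X, MvPolynomial.algHom_C, h0,
    MvPolynomial.algebraMap_eq] at h
  have h2 : (MvPolynomial.C ((2 : ℕ) : ℤ) : MvPolynomial (Fin 2 × ℕ) ℤ) ≠ 0 := by
    rw [Ne, MvPolynomial.C_eq_zero]; norm_num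
  -- The ghost component of index one determines twice this polynomial, and `2` is cancelled over
  -- `ℤ`.
  apply mul_left_cancel₀ h2
  have h3 : (MvPolynomial.C ((2 : ℕ) : ℤ) : MvPolynomial (Fin 2 × ℕ) ℤ) = 2 := by simp
  rw [h3] at h ⊢
  linear_combination h

section Addition

section Coordinates

variable {A : Type*}

@[simp] theorem W2.coeff_pair_zero (x y : A) : (W2.pair x y).coeff 0 = x := by
  simp [W2.pair]

@[simp] theorem W2.coeff_pair_one (x y : A) : (W2.pair x y).coeff 1 = y := by
  simp [W2.pair]

@[ext] theorem W2.ext {v w : W2 A} (h0 : v.coeff 0 = w.coeff 0) (h1 : v.coeff 1 = w.coeff 1) :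
    v = w := by
  apply TruncatedWittVector.ext
  intro i
  fin_cases i
  · exact h0
  · exact h1

end Coordinates

variable {A : Type*} [CommRing A]

theorem W2.coeff_add_zero (v w : W2 A) :
    (v + w).coeff 0 = v.coeff 0 + w.coeff 0 := by
  obtain ⟨X, rfl⟩ := WittVector.truncate_surjective 2 2 A v
  obtain ⟨Y, rfl⟩ := WittVector.truncate_surjective 2 2 A w
  rw [← map_add, WittVector.coeff_truncate, WittVector.coeff_truncate, WittVector.coeff_truncate]
  exact WittVector.add_coeff_zero X Y

theorem W2.coeff_add_one (v w : W2 A) :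
    (v + w).coeff 1 = v.coeff 1 + w.coeff 1 - v.coeff 0 * w.coeff 0 := by
  obtain ⟨X, rfl⟩ := WittVector.truncate_surjective 2 2 A v
  obtain ⟨Y, rfl⟩ := WittVector.truncate_surjective 2 2 A w
  rw [← map_add, WittVector.coeff_truncate, WittVector.coeff_truncate, WittVector.coeff_truncate,
    WittVector.coeff_truncate, WittVector.coeff_truncate]
  simp [WittVector.add_coeff, wittAdd_one, WittVector.peval]

theorem W2.pair_zero_zero : (W2.pair 0 0 : W2 A) = 0 := by
  ext <;> simp

theorem W2.pair_add_pair [CharP A 2] (x y x' y' : A) :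
    W2.pair x y + W2.pair x' y' = W2.pair (x + x') (y + y' + x * x') := by
  ext
  · simp [W2.coeff_add_zero]
  · simp [W2.coeff_add_one, CharTwo.sub_eq_add]

theorem W2.map_pair {B : Type*} [CommRing B] (f : A →+* B) (x y : A) :
    W2.map f (W2.pair x y) = W2.pair (f x) (f y) := by
  ext <;> simp [W2.coeff_map]

theorem W2.map_injective {B : Type*} [CommRing B] {f : A →+* B} (hf : Function.Injective f) :
    Function.Injective (W2.map f) := by
  intro v w h
  have h' := fun j => congrArg (TruncatedWittVector.coeff j) h
  simp only [W2.coeff_map] at h'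
  ext
  · exact hf (h' 0)
  · exact hf (h' 1)

end Addition

/-! ### Subfields of a finite field -/

theorem pow_two_pow_finrank {K : Type*} [Field K] [Finite K] [Algebra (ZMod 2) K] (x : K) :
    x ^ 2 ^ Module.finrank (ZMod 2) K = x := by
  have := Fintype.ofFinite K
  have h := FiniteField.pow_card x
  rwa [Module.card_eq_pow_finrank (K := ZMod 2) (V := K), ZMod.card] at h

theorem X_pow_sub_X_dvd {R : Type*} [CommRing R] (q r : ℕ) :
    (Polynomial.X ^ q - Polynomial.X : R[X]) ∣ Polynomial.X ^ q ^ r - Polynomial.X := by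
  induction r with
  | zero => simp
  | succ r ih =>
    have h := (ih.trans (sub_dvd_pow_sub_pow _ _ q)).add
      (dvd_refl (Polynomial.X ^ q - Polynomial.X : R[X]))
    rwa [sub_add_sub_cancel, ← pow_mul, ← pow_succ] at h

/-- `X ^ 2 ^ d - X` divides `X ^ |K| - X`, which splits over `K` with simple roots. -/
theorem card_pow_two_pow_eq_self {K : Type*} [Field K] [Fintype K] [DecidableEq K]
    [Algebra (ZMod 2) K] {d : ℕ} (hd : d ∣ Module.finrank (ZMod 2) K) :
    (Finset.univ.filter fun x : K => x ^ 2 ^ d = x).card = 2 ^ d := by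
  have hm : 0 < Module.finrank (ZMod 2) K := Module.finrank_pos
  have hd0 : d ≠ 0 := by rintro rfl; simp at hd; omega
  have h1 : 1 < 2 ^ d := Nat.one_lt_two_pow hd0
  have hc : Fintype.card K = 2 ^ Module.finrank (ZMod 2) K := by
    rw [Module.card_eq_pow_finrank (K := ZMod 2) (V := K), ZMod.card]
  obtain ⟨r, hr⟩ := hd
  have hdvd : (Polynomial.X ^ 2 ^ d - Polynomial.X : K[X]) ∣
      Polynomial.X ^ Fintype.card K - Polynomial.X := by
    rw [hc, hr, pow_mul]
    exact X_pow_sub_X_dvd _ _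
  have h0 := FiniteField.X_pow_card_sub_X_ne_zero K (Fintype.one_lt_card (α := K))
  have h0' := FiniteField.X_pow_card_sub_X_ne_zero K h1
  have hsplit : (Polynomial.X ^ Fintype.card K - Polynomial.X : K[X]).Splits := by
    simpa using FiniteField.splits_X_pow_card_sub_X 2 (K := K)
  replace hsplit := hsplit.of_dvd h0 hdvd
  have hnodup : (Polynomial.X ^ 2 ^ d - Polynomial.X : K[X]).roots.Nodup := by
    refine Multiset.nodup_of_le (Polynomial.roots.le_of_dvd h0 hdvd) ?_
    rw [FiniteField.roots_X_pow_card_sub_X]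
    exact Finset.univ.nodup
  trans (Polynomial.X ^ 2 ^ d - Polynomial.X : K[X]).natDegree
  swap
  · exact FiniteField.X_pow_card_sub_X_natDegree_eq K h1
  rw [hsplit.natDegree_eq_card_roots, ← Multiset.toFinset_card_of_nodup hnodup]
  congr 1
  ext x
  simp [Polynomial.mem_roots h0', sub_eq_zero]

/-! ### The character `psi` and its quadratic refinement `Q` -/

section Characters

variable {K : Type*} [Field K] [Finite K] [Algebra (ZMod 2) K] [CharP K 2]

theorem wittTrace_add (v w : W2 K) : wittTrace (v + w) = wittTrace v + wittTrace w := by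
  apply W2.map_injective (algebraMap (ZMod 2) K).injective
  simp only [map_add, map_wittTrace, conjSum, Finset.sum_add_distrib]

theorem wittTrace_frobenius (w : W2 K) : wittTrace (W2.map (frobenius K 2) w) = wittTrace w := by
  apply W2.map_injective (algebraMap (ZMod 2) K).injective
  simp only [map_wittTrace, conjSum]
  have h1 := Finset.sum_range_succ
    (fun i => W2.map (iterateFrobenius K 2 i) w) (Module.finrank (ZMod 2) K)
  have h2 := Finset.sum_range_succ'
    (fun i => W2.map (iterateFrobenius K 2 i) w) (Module.finrank (ZMod 2) K)
  have hend : W2.map (iterateFrobenius K 2 (Module.finrank (ZMod 2) K)) w =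
      W2.map (iterateFrobenius K 2 0) w := by
    apply W2.ext <;> simp only [W2.coeff_map, iterateFrobenius_def, pow_two_pow_finrank, pow_zero, pow_one]
  rw [h1, hend] at h2
  rw [add_right_cancel h2]
  refine Finset.sum_congr rfl fun i _ => ?_
  apply W2.ext <;> simp only [W2.coeff_map, frobenius_def, iterateFrobenius_def, pow_succ', pow_mul]

theorem wittTrace_pair_zero (x : K) :
    wittTrace (W2.pair 0 x) = W2.pair 0 (Algebra.trace (ZMod 2) K x) := by
  apply W2.map_injective (algebraMap (ZMod 2) K).injective
  rw [map_wittTrace, W2.map_pair, FiniteField.algebraMap_trace_eq_sum_pow, conjSum, map_zero,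
    Nat.card_zmod]
  induction Finset.range (Module.finrank (ZMod 2) K) using Finset.induction_on with
  | empty => simp [W2.pair_zero_zero]
  | insert a s ha ih =>
    rw [Finset.sum_insert ha, Finset.sum_insert ha, ih, W2.map_pair, W2.pair_add_pair]
    simp [iterateFrobenius_def]

variable {C : Type*} [CommRing C] (ξ : AddChar (W2 (ZMod 2)) C)

theorem Q_mul_Q (x y : K) : Q ξ x * Q ξ y = Q ξ (x + y) * psi ξ (x * y) := by
  rw [Q, Q, Q, psi, ← AddChar.map_add_eq_mul, ← AddChar.map_add_eq_mul, ← wittTrace_add,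
    ← wittTrace_add, W2.pair_add_pair, W2.pair_add_pair]
  simp

@[simp] theorem psi_zero : psi ξ (0 : K) = 1 := by
  rw [psi, wittTrace_pair_zero, map_zero, W2.pair_zero_zero, AddChar.map_zero_eq_one]

theorem psi_add (x y : K) : psi ξ (x + y) = psi ξ x * psi ξ y := by
  rw [psi, psi, psi, ← AddChar.map_add_eq_mul, ← wittTrace_add, W2.pair_add_pair]
  simp

theorem psi_mul_self (x : K) : psi ξ x * psi ξ x = 1 := by
  rw [← psi_add, CharTwo.add_self_eq_zero, psi_zero]

@[simp] theorem Q_zero : Q ξ (0 : K) = 1 := by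
  exact psi_zero ξ (K := K)

theorem psi_sq (x : K) : psi ξ (x ^ 2) = psi ξ x := by
  rw [psi, psi, ← wittTrace_frobenius (W2.pair 0 x), W2.map_pair]
  simp [frobenius_def]

theorem Q_sq (x : K) : Q ξ (x ^ 2) = Q ξ x := by
  rw [Q, Q, ← wittTrace_frobenius (W2.pair x 0), W2.map_pair]
  simp [frobenius_def]

theorem Q_mul_self (x : K) : Q ξ x * Q ξ x = psi ξ x := by
  rw [Q_mul_Q, CharTwo.add_self_eq_zero, Q_zero, one_mul, ← sq, psi_sq]

theorem psi_pow_two_pow (i : ℕ) (x : K) : psi ξ (x ^ 2 ^ i) = psi ξ x := by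
  induction i with
  | zero => simp
  | succ i ih => rw [pow_succ, pow_mul, psi_sq, ih]

theorem Q_pow_two_pow (i : ℕ) (x : K) : Q ξ (x ^ 2 ^ i) = Q ξ x := by
  induction i with
  | zero => simp
  | succ i ih => rw [pow_succ, pow_mul, Q_sq, ih]

theorem Q_one : Q ξ (1 : K) = ξ (W2.pair 1 0) ^ Module.finrank (ZMod 2) K := by
  rw [← AddChar.map_nsmul_eq_pow, Q]
  congr 1
  apply W2.map_injective (algebraMap (ZMod 2) K).injective
  rw [map_wittTrace, map_nsmul, W2.map_pair, conjSum]
  simp [W2.map_pair]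

theorem psi_sum {ι : Type*} (s : Finset ι) (f : ι → K) :
    psi ξ (∑ i ∈ s, f i) = ∏ i ∈ s, psi ξ (f i) := by
  classical
  induction s using Finset.induction_on with
  | empty => simp
  | insert a s ha ih => rw [Finset.sum_insert ha, Finset.prod_insert ha, psi_add, ih]

/-- Iterating `Q_mul_Q` makes the second elementary symmetric function appear, the shape shared by
`x R_F(x)` and `γ_F`. -/
theorem prod_Q_range (z : ℕ → K) (n : ℕ) :
    ∏ i ∈ Finset.range n, Q ξ (z i) = Q ξ (∑ i ∈ Finset.range n, z i) *
      psi ξ (∑ j ∈ Finset.range n, ∑ i ∈ Finset.range j, z i * z j) := by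
  induction n with
  | zero => simp
  | succ n ih =>
    rw [Finset.prod_range_succ, ih, Finset.sum_range_succ _ n, Finset.sum_range_succ _ n,
      psi_add, ← Finset.sum_mul, mul_right_comm, Q_mul_Q]
    ring

theorem psi_one_pair [IsDomain C] (hξ : Function.Injective ξ) : ξ (W2.pair 0 1) = -1 := by
  have h1 : ξ (W2.pair 0 1) * ξ (W2.pair 0 1) = 1 := by
    rw [← AddChar.map_add_eq_mul, W2.pair_add_pair, CharTwo.add_self_eq_zero,
      CharTwo.add_self_eq_zero, mul_zero, add_zero, W2.pair_zero_zero, ξ.map_zero_eq_one]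
  refine (mul_self_eq_one_iff.mp h1).resolve_left fun h => ?_
  rw [← ξ.map_zero_eq_one, ← W2.pair_zero_zero] at h
  have := congrArg (TruncatedWittVector.coeff 1) (hξ h)
  simp at this

theorem psi_eq_neg_one_pow [IsDomain C] (hξ : Function.Injective ξ) (x : K) :
    psi ξ x = if Algebra.trace (ZMod 2) K x = 0 then 1 else -1 := by
  rw [psi, wittTrace_pair_zero]
  have : ∀ c : ZMod 2, c = 0 ∨ c = 1 := by decide
  rcases this (Algebra.trace (ZMod 2) K x) with h | h
  · rw [h, if_pos rfl, W2.pair_zero_zero, ξ.map_zero_eq_one]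
  · rw [h, if_neg one_ne_zero, psi_one_pair ξ hξ]

end Characters

/-! ### Orthogonality and Poisson summation -/

section Orthogonality

variable {K : Type*} [Field K] [Fintype K] [DecidableEq K] [Algebra (ZMod 2) K] [CharP K 2]
  {C : Type*} [Field C] (ξ : AddChar (W2 (ZMod 2)) C)

theorem sum_psi_mul [CharZero C] (hξ : Function.Injective ξ) (c : K) :
    ∑ x : K, psi ξ (x * c) = if c = 0 then (Fintype.card K : C) else 0 := by
  split_ifs with h
  · simp [h]
  obtain ⟨t, ht⟩ := Algebra.trace_surjective (ZMod 2) K 1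
  have ht' : psi ξ t = -1 := by
    rw [psi_eq_neg_one_pow ξ hξ, if_neg (by rw [ht]; exact one_ne_zero)]
  have h1 : ∑ x : K, psi ξ (x * c) = ∑ x : K, psi ξ ((x + t / c) * c) :=
    (Equiv.sum_comp (Equiv.addRight (t / c)) (fun x => psi ξ (x * c))).symm
  simp_rw [add_mul, div_mul_cancel₀ t h, psi_add, ht', mul_neg_one, Finset.sum_neg_distrib] at h1
  exact self_eq_neg.mp h1

/-- The number of preimages under a map with an adjoint for the trace form. -/
theorem card_fiber_eq_sum_psi [CharZero C] (hξ : Function.Injective ξ) {L L' : K → K}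
    (h : ∀ x y, psi ξ (L x * y) = psi ξ (x * L' y)) (z : K) :
    ((Finset.univ.filter fun x => L x = z).card : C) =
      ∑ c ∈ Finset.univ.filter (fun c => L' c = 0), psi ξ (c * z) := by
  have hq : (Fintype.card K : C) ≠ 0 := by simp
  apply mul_left_cancel₀ hq
  calc (Fintype.card K : C) * ((Finset.univ.filter fun x => L x = z).card : C)
      = ∑ x : K, ∑ y : K, psi ξ (y * (L x + z)) := by
        simp_rw [sum_psi_mul ξ hξ, CharTwo.add_eq_zero, ← Finset.sum_filter]
        simp [mul_comm]
    _ = ∑ y : K, psi ξ (y * z) * ∑ x : K, psi ξ (x * L' y) := by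
        rw [Finset.sum_comm]
        refine Finset.sum_congr rfl fun y _ => ?_
        rw [Finset.mul_sum]
        refine Finset.sum_congr rfl fun x _ => ?_
        rw [mul_add, psi_add, mul_comm y, h, mul_comm]
    _ = _ := by
        simp_rw [sum_psi_mul ξ hξ, mul_ite, mul_zero, ← Finset.sum_filter, Finset.mul_sum, mul_comm]

/-- Poisson summation: grouping by the value of `L` reduces this to the fibre count. -/
theorem sum_comp_eq_sum_psi [CharZero C] (hξ : Function.Injective ξ) {L L' : K → K}
    (h : ∀ x y, psi ξ (L x * y) = psi ξ (x * L' y)) (f : K → C) :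
    ∑ x, f (L x) = ∑ c ∈ Finset.univ.filter (fun c => L' c = 0), ∑ y, f y * psi ξ (c * y) := by
  rw [Finset.sum_comm, ← Finset.sum_fiberwise_of_maps_to (g := L) (t := Finset.univ) (by simp)]
  refine Finset.sum_congr rfl fun y _ => ?_
  rw [← Finset.mul_sum, ← card_fiber_eq_sum_psi ξ hξ h, Finset.sum_congr rfl
    (g := fun _ => f y) (by simp +contextual)]
  simp [mul_comm]

end Orthogonality

/-! ### The sum of `Q` over a field of square order -/

section GaussSum

variable {K : Type*} [Field K] [Fintype K] [DecidableEq K] [Algebra (ZMod 2) K] [CharP K 2]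
  {C : Type*} [Field C] (ξ : AddChar (W2 (ZMod 2)) C)

omit [Fintype K] [DecidableEq K] in
theorem map_wittTrace_of_finrank_eq [Finite K] {k : ℕ} (hk : Module.finrank (ZMod 2) K = 2 * k)
    (w : W2 K) :
    W2.map (algebraMap (ZMod 2) K) (wittTrace w) = ∑ i ∈ Finset.range k,
      W2.map (iterateFrobenius K 2 i) (w + W2.map (iterateFrobenius K 2 k) w) := by
  simp_rw [map_wittTrace, conjSum, hk, two_mul, Finset.sum_range_add, map_add,
    Finset.sum_add_distrib]
  congr 1
  refine Finset.sum_congr rfl fun i _ => ?_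
  apply W2.ext <;> simp only [W2.coeff_map, iterateFrobenius_def, ← pow_mul, ← pow_add]

omit [Fintype K] [DecidableEq K] in
theorem wittTrace_congr [Finite K] {k : ℕ} (hk : Module.finrank (ZMod 2) K = 2 * k) {v w : W2 K}
    (h : v + W2.map (iterateFrobenius K 2 k) v = w + W2.map (iterateFrobenius K 2 k) w) :
    wittTrace v = wittTrace w := by
  apply W2.map_injective (algebraMap (ZMod 2) K).injective
  rw [map_wittTrace_of_finrank_eq hk, map_wittTrace_of_finrank_eq hk, h]

omit [Fintype K] [DecidableEq K] in
theorem psi_eq_one_of_pow_eq [Finite K] {k : ℕ} (hk : Module.finrank (ZMod 2) K = 2 * k) {u : K}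
    (hu : u ^ 2 ^ k = u) : psi ξ u = 1 := by
  rw [← psi_zero ξ (K := K), psi, psi]
  congr 1
  apply wittTrace_congr hk
  rw [W2.map_pair, W2.map_pair, W2.pair_add_pair, W2.pair_add_pair]
  simp [iterateFrobenius_def, hu, CharTwo.add_self_eq_zero]

omit [Fintype K] [DecidableEq K] in
-- The trace factors through `v + v^σ` for the involution `σ`, `x ↦ x ^ 2 ^ k`. Both `(u, 0)` and
-- `(0, u² w)` give `(0, u²)` there. Then `u² w` is traded for `(u w)²`, because `w² + w` is fixed
-- by `σ`.
theorem Q_eq_psi_mul [Finite K] {k : ℕ} (hk : Module.finrank (ZMod 2) K = 2 * k) {u w : K}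
    (hu : u ^ 2 ^ k = u) (hw : w + w ^ 2 ^ k = 1) : Q ξ u = psi ξ (u * w) := by
  have hw' : w ^ 2 ^ k = w + 1 := by
    rw [← hw, ← add_assoc, CharTwo.add_self_eq_zero, zero_add]
  have h1 : Q ξ u = psi ξ (u ^ 2 * w) := by
    rw [Q, psi]
    congr 1
    apply wittTrace_congr hk
    rw [W2.map_pair, W2.map_pair, W2.pair_add_pair, W2.pair_add_pair]
    simp only [iterateFrobenius_def, map_zero, hu, CharTwo.add_self_eq_zero, mul_pow, hw',
      ← pow_mul, mul_comm 2 (2 ^ k)]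
    rw [pow_mul, hu]
    congr 1
    linear_combination -CharTwo.add_self_eq_zero (u ^ 2 * w)
  have h2 : psi ξ (u ^ 2 * (w ^ 2 + w)) = 1 := by
    apply psi_eq_one_of_pow_eq ξ hk
    rw [mul_pow, ← iterateFrobenius_def 2, ← iterateFrobenius_def 2, map_pow, map_add, map_pow,
      iterateFrobenius_def, iterateFrobenius_def, hu, hw']
    linear_combination u ^ 2 * CharTwo.add_self_eq_zero (w + 1)
  rw [← psi_sq, mul_pow, h1, ← one_mul (psi ξ (u ^ 2 * w)), ← h2, ← psi_add]
  congr 1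
  linear_combination u ^ 2 * CharTwo.add_self_eq_zero w

omit [Fintype K] [DecidableEq K] in
-- Here `(w, 0) + (w + 1, 0) = (1, w² + w)`. In the sum of its first `k` conjugates the second
-- coordinates telescope to `w ^ 2 ^ k + w = 1`, and the extra `(0, 1)` produces the sign.
theorem Q_eq_of_add_pow_eq_one [Finite K] {k : ℕ} (hk : Module.finrank (ZMod 2) K = 2 * k)
    (hξ : Function.Injective ξ) {w : K} (hw : w + w ^ 2 ^ k = 1) :
    Q ξ w = -ξ (W2.pair 1 0) ^ k := by
  have hw' : w ^ 2 ^ k = w + 1 := by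
    rw [← hw, ← add_assoc, CharTwo.add_self_eq_zero, zero_add]
  have hsum : ∀ j, ∑ i ∈ Finset.range j,
      W2.map (iterateFrobenius K 2 i) (W2.pair 1 (w ^ 2 + w)) =
        j • W2.pair 1 0 + W2.pair 0 (w ^ 2 ^ j + w) := by
    intro j
    induction j with
    | zero => simp [CharTwo.add_self_eq_zero, W2.pair_zero_zero]
    | succ j ih =>
      rw [Finset.sum_range_succ, ih, succ_nsmul, add_assoc, add_assoc, W2.map_pair,
        W2.pair_add_pair, W2.pair_add_pair]
      simp only [map_one, map_add, map_pow, iterateFrobenius_def]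
      congr 2
      · ring
      · rw [← pow_mul, ← pow_succ]
        linear_combination CharTwo.add_self_eq_zero (w ^ 2 ^ j)
  have h : wittTrace (W2.pair w 0) = k • W2.pair 1 0 + W2.pair 0 1 := by
    apply W2.map_injective (algebraMap (ZMod 2) K).injective
    rw [map_wittTrace_of_finrank_eq hk, W2.map_pair, W2.pair_add_pair]
    simp only [map_zero, iterateFrobenius_def, hw', add_zero]
    rw [map_add, map_nsmul, W2.map_pair, W2.map_pair]
    simp only [zero_add, map_one, map_zero]
    rw [← hw', hw, hw', show w * (w + 1) = w ^ 2 + w by ring, hsum, add_comm (w ^ 2 ^ k), hw]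
  rw [Q, h, ξ.map_add_eq_mul, ξ.map_nsmul_eq_pow, psi_one_pair ξ hξ]
  ring

omit [DecidableEq K] in
/-- The quadratic Gauss sum of a field of square order. -/
theorem sum_Q [CharZero C] (hξ : Function.Injective ξ) {k : ℕ}
    (hk : Module.finrank (ZMod 2) K = 2 * k) :
    ∑ x : K, Q ξ x = -(2 ^ k * ξ (W2.pair 1 0) ^ k) := by
  classical
  have hx : ∀ x : K, (x ^ 2 ^ k) ^ 2 ^ k = x := fun x => by
    rw [← pow_mul, ← pow_add, ← two_mul, ← hk, pow_two_pow_finrank]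
  have hadj : ∀ x y : K, psi ξ ((x + x ^ 2 ^ k) * y) = psi ξ (x * (y + y ^ 2 ^ k)) := by
    intro x y
    rw [add_mul, mul_add, psi_add, psi_add, ← psi_pow_two_pow ξ k (x ^ 2 ^ k * y), mul_pow, hx]
  have hfix : ∀ c : K, c + c ^ 2 ^ k = 0 ↔ c ^ 2 ^ k = c := fun c => by
    rw [CharTwo.add_eq_zero, eq_comm]
  have hcard := card_pow_two_pow_eq_self (K := K) (d := k) ⟨2, by rw [hk, mul_comm]⟩
  have hone := card_fiber_eq_sum_psi ξ hξ hadj 1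
  rw [Finset.sum_congr rfl (g := fun _ => (1 : C)) (fun c hc => by
    rw [mul_one]
    exact psi_eq_one_of_pow_eq ξ hk ((hfix c).mp (Finset.mem_filter.mp hc).2))] at hone
  simp only [hfix, Finset.sum_const, hcard, nsmul_eq_mul, mul_one] at hone
  -- By `hone` there are `2 ^ k` such elements, since `psi` is trivial on the fixed field.
  obtain ⟨w, hw⟩ : ∃ w : K, w + w ^ 2 ^ k = 1 := by
    have hne : (Finset.univ.filter fun x : K => x + x ^ 2 ^ k = 1).card ≠ 0 := by
      have := Nat.cast_injective hone
      rw [this]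
      positivity
    obtain ⟨w, hw⟩ := Finset.card_ne_zero.mp hne
    exact ⟨w, (Finset.mem_filter.mp hw).2⟩
  -- The sum of `Q (w + x + x ^ 2 ^ k)` is computed twice: each term is `Q w`, while Poisson
  -- summation gives `2 ^ k` copies of the sum of `Q`.
  have h1 := sum_comp_eq_sum_psi ξ hξ hadj (fun y => Q ξ (w + y))
  have hl : ∀ x : K, Q ξ (w + (x + x ^ 2 ^ k)) = Q ξ w := by
    intro x
    have hu : (x + x ^ 2 ^ k) ^ 2 ^ k = x + x ^ 2 ^ k := by
      rw [← iterateFrobenius_def 2, map_add, iterateFrobenius_def, iterateFrobenius_def, hx, add_comm]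
    have h2 := Q_mul_Q ξ w (x + x ^ 2 ^ k)
    rw [Q_eq_psi_mul ξ hk hu hw, mul_comm w] at h2
    exact (mul_right_cancel₀ (left_ne_zero_of_mul_eq_one (psi_mul_self ξ _)) h2).symm
  have hr : ∀ c ∈ Finset.univ.filter (fun c : K => c + c ^ 2 ^ k = 0),
      ∑ y : K, Q ξ (w + y) * psi ξ (c * y) = ∑ y : K, Q ξ y := by
    intro c hc
    replace hc := (hfix c).mp (Finset.mem_filter.mp hc).2
    rw [← Equiv.sum_comp ((Equiv.addLeft w).trans (Equiv.addRight c)) (Q ξ)]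
    refine Finset.sum_congr rfl fun y _ => ?_
    have h2 := Q_mul_Q ξ (w + y) c
    rw [Q_eq_psi_mul ξ hk hc hw, add_mul, psi_add, mul_comm w, mul_comm y, mul_comm (psi ξ (c * w)),
      ← mul_assoc] at h2
    rw [mul_right_cancel₀ (left_ne_zero_of_mul_eq_one (psi_mul_self ξ _)) h2, mul_assoc,
      psi_mul_self, mul_one]
    rfl
  have hq : (Fintype.card K : C) = 2 ^ k * 2 ^ k := by
    rw [Module.card_eq_pow_finrank (K := ZMod 2) (V := K), ZMod.card, hk, two_mul, pow_add]
    simp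
  rw [Finset.sum_congr rfl (fun x _ => hl x), Finset.sum_congr rfl hr] at h1
  simp only [hfix, Finset.sum_const, hcard, nsmul_eq_mul, Finset.card_univ, hq,
    Q_eq_of_add_pow_eq_one ξ hk hξ hw, Nat.cast_pow, Nat.cast_ofNat] at h1
  have h2 : (2 ^ k : C) ≠ 0 := pow_ne_zero _ two_ne_zero
  apply mul_left_cancel₀ h2
  rw [← h1]
  ring

end GaussSum

/-! ### Double sums and iterated roots -/

section DoubleSums

variable {M : Type*} [AddCommMonoid M]

theorem sum_Icc_sum_range_eq (e : ℕ) (f : ℕ → ℕ → M) :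
    ∑ i ∈ Finset.Icc 1 e, ∑ j ∈ Finset.range (e - i + 1), f j (j + i) =
      ∑ k ∈ Finset.range (e + 1), ∑ j ∈ Finset.range k, f j k := by
  rw [Finset.sum_sigma', Finset.sum_sigma']
  refine Finset.sum_bij' (fun p _ => ⟨p.2 + p.1, p.2⟩) (fun p _ => ⟨p.1 - p.2, p.2⟩) ?_ ?_ ?_ ?_ ?_
  · rintro ⟨i, j⟩ h
    simp at h ⊢
    omega
  · rintro ⟨i, j⟩ h
    simp at h ⊢
    omega
  · rintro ⟨i, j⟩ h
    simp
  · rintro ⟨i, j⟩ h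
    simp at h ⊢
    omega
  · rintro ⟨i, j⟩ h
    rfl

theorem sum_range_sum_range_eq (n : ℕ) (f : ℕ → ℕ → M) :
    ∑ j ∈ Finset.range n, ∑ k ∈ Finset.range n, f j k =
      (∑ k ∈ Finset.range n, ∑ j ∈ Finset.range k, f j k) +
      (∑ k ∈ Finset.range n, ∑ j ∈ Finset.range k, f k j) + ∑ k ∈ Finset.range n, f k k := by
  induction n with
  | zero => simp
  | succ n ih =>
    simp only [Finset.sum_range_succ, Finset.sum_add_distrib, ih]
    abel

end DoubleSums

section Roots

variable {L : Type*} [CommRing L] [ExpChar L 2] [PerfectRing L 2] (s : ℕ)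

theorem pRoot_pow (i : ℕ) (x : L) : pRoot s i x ^ 2 ^ (s * i) = x := by
  rw [pRoot, ← iterateFrobeniusEquiv_def, RingEquiv.apply_symm_apply]

theorem pRoot_eq_iff (i : ℕ) (x y : L) : pRoot s i x = y ↔ x = y ^ 2 ^ (s * i) := by
  rw [pRoot, RingEquiv.symm_apply_eq, iterateFrobeniusEquiv_def]

theorem pRoot_mul (i : ℕ) (x y : L) : pRoot s i (x * y) = pRoot s i x * pRoot s i y :=
  map_mul _ _ _

theorem pRoot_add (i : ℕ) (x y : L) : pRoot s i (x + y) = pRoot s i x + pRoot s i y :=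
  map_add _ _ _

theorem pRoot_sum {ι : Type*} (i : ℕ) (t : Finset ι) (f : ι → L) :
    pRoot s i (∑ k ∈ t, f k) = ∑ k ∈ t, pRoot s i (f k) :=
  map_sum _ _ _

theorem pRoot_pow_self (i : ℕ) (x : L) : pRoot s i (x ^ (2 ^ s) ^ i) = x := by
  rw [pRoot_eq_iff, pow_mul]

theorem pRoot_pRoot (i j : ℕ) (x : L) : pRoot s i (pRoot s j x) = pRoot s (i + j) x := by
  rw [eq_comm, pRoot_eq_iff, mul_add, pow_add, pow_mul, pRoot_pow, pRoot_pow]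

theorem pRoot_pow_add (i j : ℕ) (x : L) :
    pRoot s i (x ^ (2 ^ s) ^ (i + j)) = x ^ (2 ^ s) ^ j := by
  rw [pow_add, mul_comm, pow_mul, pRoot_pow_self]

theorem algebraMap_pRoot {K : Type*} [CommRing K] [ExpChar K 2] [PerfectRing K 2] [Algebra K L]
    (i : ℕ) (x : K) : algebraMap K L (pRoot s i x) = pRoot s i (algebraMap K L x) := by
  rw [eq_comm, pRoot_eq_iff, ← map_pow, pRoot_pow]

end Roots

/-! ### The factorization of `E` and the size of the kernel of `F^*` -/

section Factorization

variable {K : Type*} [Field K] (s e : ℕ)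

theorem coeff_polyR (hs : 1 ≤ s) (a : ℕ → K) {i : ℕ} (hi : i ∈ Finset.Icc 1 e) :
    (polyR s e a).coeff ((2 ^ s) ^ i) = a i := by
  have h2 : 2 ≤ 2 ^ s := by simpa using Nat.pow_le_pow_right (n := 2) (by norm_num) hs
  simp only [polyR, Polynomial.finsetSum_coeff, Polynomial.coeff_C_mul, Polynomial.coeff_X_pow,
    (Nat.pow_right_injective h2).eq_iff]
  rw [Finset.sum_eq_single i] <;> simp +contextual [eq_comm, Finset.mem_Icc.mp hi]

theorem coeff_polyF (hs : 1 ≤ s) (b : ℕ → K) :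
    (polyF s e b).coeff ((2 ^ s) ^ e) = b e := by
  have h2 : 2 ≤ 2 ^ s := by simpa using Nat.pow_le_pow_right (n := 2) (by norm_num) hs
  simp only [polyF, Polynomial.finsetSum_coeff, Polynomial.coeff_C_mul, Polynomial.coeff_X_pow,
    (Nat.pow_right_injective h2).eq_iff]
  rw [Finset.sum_eq_single e] <;> simp +contextual [eq_comm]

theorem eval_polyF (b : ℕ → K) (x : K) :
    (polyF s e b).eval x = ∑ i ∈ Finset.range (e + 1), b i * x ^ (2 ^ s) ^ i := by
  simp [polyF, Polynomial.eval_finsetSum]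

variable (L : Type*) [Field L] [Algebra K L] [ExpChar L 2] [PerfectRing L 2]

/-- The equality `R = R_F` concerns polynomials, whereas `mapE` also uses the coefficients. These
are recovered because the exponents `p ^ i` are distinct. -/
theorem mapE_congr (hs : 1 ≤ s) {a a' : ℕ → K} (h : polyR s e a = polyR s e a') (x : L) :
    mapE s e L a x = mapE s e L a' x := by
  rw [mapE, mapE, h]
  congr 1
  refine Finset.sum_congr rfl fun i hi => ?_
  rw [← coeff_polyR s e hs a hi, h, coeff_polyR s e hs a' hi]

theorem algebraMap_adjF [ExpChar K 2] [PerfectRing K 2] (b : ℕ → K) (x : K) :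
    algebraMap K L (adjF s e K b x) = adjF s e L b (algebraMap K L x) := by
  simp [adjF, algebraMap_pRoot]

/-- In the expansion of `F^* ∘ F` the terms `j < k` give `R_F`, the terms `j > k` give its adjoint,
and the diagonal is `x * F^*(1) ^ 2 = 0`. -/
theorem adjF_aeval_polyF [Finite K] [CharP K 2] {b : ℕ → K} (h1 : adjF s e L b 1 = 0) (x : L) :
    adjF s e L b (Polynomial.aeval x (polyF s e b)) = mapE s e L (coeffRF s e b) x := by
  set c : ℕ → L := fun i => algebraMap K L (b i) with hc
  have hl : adjF s e L b (Polynomial.aeval x (polyF s e b)) =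
      ∑ j ∈ Finset.range (e + 1), ∑ k ∈ Finset.range (e + 1),
        pRoot s j (c j * c k * x ^ (2 ^ s) ^ k) := by
    simp [adjF, polyF, Finset.mul_sum, pRoot_sum, mul_assoc, hc]
  have hr1 : Polynomial.aeval x (polyR s e (coeffRF s e b)) =
      ∑ i ∈ Finset.Icc 1 e, ∑ j ∈ Finset.range (e - i + 1),
        pRoot s j (c j * c (j + i) * x ^ (2 ^ s) ^ (j + i)) := by
    simp [polyR, coeffRF, Finset.sum_mul, algebraMap_pRoot, pRoot_mul, pRoot_pow_add, hc]
  have hr2 : ∑ i ∈ Finset.Icc 1 e, pRoot s i (algebraMap K L (coeffRF s e b i) * x) =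
      ∑ i ∈ Finset.Icc 1 e, ∑ j ∈ Finset.range (e - i + 1),
        pRoot s (j + i) (c (j + i) * c j * x ^ (2 ^ s) ^ j) := by
    simp only [coeffRF, map_sum, algebraMap_pRoot, Finset.sum_mul, pRoot_sum]
    refine Finset.sum_congr rfl fun i _ => Finset.sum_congr rfl fun j _ => ?_
    rw [add_comm j i, ← pRoot_pRoot s i j (_ * _ * _), pRoot_mul s j (_ * _), pRoot_pow_self,
      map_mul, mul_comm (c (i + j))]
  have hd : ∑ j ∈ Finset.range (e + 1), pRoot s j (c j * c j * x ^ (2 ^ s) ^ j) = 0 := by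
    have h2 : ∑ j ∈ Finset.range (e + 1), pRoot s j (c j) * pRoot s j (c j) = 0 := by
      have : CharP L 2 := charP_of_injective_algebraMap (algebraMap K L).injective 2
      have h3 : ∑ j ∈ Finset.range (e + 1), pRoot s j (c j) = 0 := by simpa [adjF] using h1
      simp_rw [← sq, ← CharTwo.sum_sq, h3]
      simp
    simp [pRoot_mul, pRoot_pow_self, ← Finset.sum_mul, h2]
  rw [hl, sum_range_sum_range_eq, hd, add_zero, mapE, hr1, hr2,
    sum_Icc_sum_range_eq e (fun j k => pRoot s j (c j * c k * x ^ (2 ^ s) ^ k)),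
    sum_Icc_sum_range_eq e (fun j k => pRoot s k (c k * c j * x ^ (2 ^ s) ^ j))]

omit [ExpChar L 2] [PerfectRing L 2] in
theorem exists_aeval_polyF_eq [IsAlgClosed L] (hs : 1 ≤ s) {b : ℕ → K} (hb : b e ≠ 0) (w : L) :
    ∃ x : L, Polynomial.aeval x (polyF s e b) = w := by
  have hpos : 0 < (2 ^ s) ^ e := by positivity
  obtain ⟨x, hx⟩ := IsAlgClosed.exists_root
    ((polyF s e b).map (algebraMap K L) - Polynomial.C w) (by
      intro h0
      have h1 : ((polyF s e b).map (algebraMap K L) - Polynomial.C w).coeff ((2 ^ s) ^ e) ≠ 0 := by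
        rw [Polynomial.coeff_sub, Polynomial.coeff_map, coeff_polyF s e hs,
          Polynomial.coeff_C_of_ne_zero hpos.ne', sub_zero]
        simpa using hb
      have h2 := Polynomial.le_degree_of_ne_zero h1
      rw [h0] at h2
      exact absurd h2 (by simp))
  refine ⟨x, ?_⟩
  simpa [Polynomial.IsRoot, sub_eq_zero, Polynomial.eval_map_algebraMap] using hx

/-- The polynomial whose value at `x` is `F^*(x) ^ (p ^ e)`. -/
noncomputable def polyAdjF (b : ℕ → K) : K[X] :=
  ∑ i ∈ Finset.range (e + 1),
    Polynomial.C (b i ^ (2 ^ s) ^ (e - i)) * Polynomial.X ^ (2 ^ s) ^ (e - i)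

theorem aeval_polyAdjF (b : ℕ → K) (x : L) :
    Polynomial.aeval x (polyAdjF s e b) = adjF s e L b x ^ (2 ^ s) ^ e := by
  rw [adjF, ← pow_mul, sum_pow_char_pow]
  simp only [polyAdjF, map_sum, map_mul, Polynomial.aeval_C, map_pow, Polynomial.aeval_X]
  refine Finset.sum_congr rfl fun i hi => ?_
  have hi' : e = i + (e - i) := by have := Finset.mem_range.mp hi; omega
  conv_rhs => rw [hi', mul_add, pow_add, pow_mul, pRoot_pow, mul_pow, pow_mul 2]

theorem natDegree_polyAdjF (hs : 1 ≤ s) {b : ℕ → K} (hb : b 0 ≠ 0) :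
    (polyAdjF s e b).natDegree = (2 ^ s) ^ e := by
  have h2 : 2 ≤ 2 ^ s := by simpa using Nat.pow_le_pow_right (n := 2) (by norm_num) hs
  apply le_antisymm
  · refine Polynomial.natDegree_sum_le_of_forall_le _ _ fun i _ => ?_
    exact (Polynomial.natDegree_C_mul_X_pow_le _ _).trans
      (Nat.pow_le_pow_right (by omega) (Nat.sub_le _ _))
  · apply Polynomial.le_natDegree_of_ne_zero
    simp only [polyAdjF, Polynomial.finsetSum_coeff, Polynomial.coeff_C_mul,
      Polynomial.coeff_X_pow, (Nat.pow_right_injective h2).eq_iff]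
    rw [Finset.sum_eq_single 0]
    · simpa using hb
    · intro i hi hi0
      have := Finset.mem_range.mp hi
      rw [if_neg (by omega), mul_zero]
    · simp

/-- Only the linear term, `i = e`, survives differentiation, so the derivative is the nonzero
constant `b e`. -/
theorem separable_polyAdjF [CharP K 2] (hs : 1 ≤ s) {b : ℕ → K} (hb : b e ≠ 0) :
    (polyAdjF s e b).Separable := by
  have h : Polynomial.derivative (polyAdjF s e b) = Polynomial.C (b e) := by
    rw [polyAdjF, Polynomial.derivative_sum, Finset.sum_range_succ, Finset.sum_eq_zero]
    · simp
    · intro i hi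
      have hi' : e - i ≠ 0 := by have := Finset.mem_range.mp hi; omega
      have h0 : (2 : K) = 0 := CharTwo.two_eq_zero
      have hs' : s ≠ 0 := by omega
      simp [-map_pow, Polynomial.derivative_X_pow, h0, hs', hi']
  rw [Polynomial.separable_def, h]
  exact ⟨0, Polynomial.C (b e)⁻¹, by simp [← Polynomial.C_mul, hb]⟩

theorem card_ker_adjF [Fintype K] [DecidableEq K] [CharP K 2] (hs : 1 ≤ s) {b : ℕ → K}
    (hF : IsAdmissible s e b) :
    (Finset.univ.filter fun v : K => adjF s e K b v = 0).card = (2 ^ s) ^ e := by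
  have hsep := separable_polyAdjF s e hs (right_ne_zero_of_mul hF.coeff_ne_zero)
  have h := Polynomial.card_rootSet_eq_natDegree (K := AlgebraicClosure K) hsep
    (IsAlgClosed.splits _)
  have hpos : (2 ^ s) ^ e ≠ 0 := by positivity
  rw [natDegree_polyAdjF s e hs (left_ne_zero_of_mul hF.coeff_ne_zero)] at h
  have hinj := (algebraMap K (AlgebraicClosure K)).injective
  have himg : (polyAdjF s e b).rootSet (AlgebraicClosure K) = algebraMap K (AlgebraicClosure K) ''
      ((Finset.univ.filter fun v : K => adjF s e K b v = 0 : Finset K) : Set K) := by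
    ext x
    rw [Polynomial.mem_rootSet_of_ne hsep.ne_zero, aeval_polyAdjF, pow_eq_zero_iff hpos]
    constructor
    · intro hx
      obtain ⟨v, rfl⟩ := hF.ker_subset hx
      refine ⟨v, ?_, rfl⟩
      rw [← algebraMap_adjF, map_eq_zero_iff _ hinj] at hx
      simpa using hx
    · rintro ⟨v, hv, rfl⟩
      rw [← algebraMap_adjF]
      simpa using hv
  rw [← Nat.card_eq_fintype_card, himg, Nat.card_image_of_injective hinj] at h
  simpa using h

end Factorization

/-! ### Exponential sums attached to the curves -/

section ExponentialSums

variable {K : Type*} [Field K] [Fintype K] [Algebra (ZMod 2) K] [CharP K 2]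
  {C : Type*} [Field C] (ξ : AddChar (W2 (ZMod 2)) C) (s e : ℕ)

theorem psi_pRoot (i : ℕ) (x : K) : psi ξ (pRoot s i x) = psi ξ x := by
  conv_rhs => rw [← pRoot_pow s i x, psi_pow_two_pow]

theorem Q_pRoot (i : ℕ) (x : K) : Q ξ (pRoot s i x) = Q ξ x := by
  conv_rhs => rw [← pRoot_pow s i x, Q_pow_two_pow]

theorem psi_polyF_mul (b : ℕ → K) (x y : K) :
    psi ξ ((polyF s e b).eval x * y) = psi ξ (x * adjF s e K b y) := by
  rw [eval_polyF, adjF, Finset.sum_mul, Finset.mul_sum, psi_sum, psi_sum]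
  refine Finset.prod_congr rfl fun i _ => ?_
  rw [← psi_pRoot ξ s i, mul_right_comm, pRoot_mul s i (_ * _), pRoot_pow_self, mul_comm]
  rfl

/-- `prod_Q_range` is applied to `b i * x ^ p ^ i` and to its `p ^ i`-th root. The products of `Q`
agree by Frobenius invariance, and the second family sums to `x * F^*(1) = 0`. -/
theorem psi_mul_polyRF {b : ℕ → K} (h1 : adjF s e K b 1 = 0) (x : K) :
    psi ξ (x * ((polyRF s e b).eval x + gammaF s e b * x)) = Q ξ ((polyF s e b).eval x) := by
  have hR : psi ξ (x * (polyRF s e b).eval x) = psi ξ (∑ k ∈ Finset.range (e + 1),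
      ∑ j ∈ Finset.range k, b j * x ^ (2 ^ s) ^ j * (b k * x ^ (2 ^ s) ^ k)) := by
    have h2 : x * (polyRF s e b).eval x = ∑ i ∈ Finset.Icc 1 e, ∑ j ∈ Finset.range (e - i + 1),
        pRoot s j (b j * x ^ (2 ^ s) ^ j * (b (j + i) * x ^ (2 ^ s) ^ (j + i))) := by
      simp only [polyRF, polyR, coeffRF, Polynomial.eval_finsetSum, Polynomial.eval_mul,
        Polynomial.eval_C, Polynomial.eval_pow, Polynomial.eval_X, Finset.mul_sum, Finset.sum_mul,
        pRoot_mul, pRoot_pow_add, pRoot_pow_self]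
      refine Finset.sum_congr rfl fun i _ => Finset.sum_congr rfl fun j _ => ?_
      ring
    rw [h2, sum_Icc_sum_range_eq e
      (fun j k => pRoot s j (b j * x ^ (2 ^ s) ^ j * (b k * x ^ (2 ^ s) ^ k)))]
    simp only [psi_sum, psi_pRoot]
  have hF := prod_Q_range ξ (fun i => b i * x ^ (2 ^ s) ^ i) (e + 1)
  have hγ := prod_Q_range ξ (fun i => pRoot s i (b i) * x) (e + 1)
  have hQ : ∀ i, Q ξ (pRoot s i (b i) * x) = Q ξ (b i * x ^ (2 ^ s) ^ i) := by
    intro i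
    rw [← Q_pRoot ξ s i (_ * _ ^ _), pRoot_mul, pRoot_pow_self]
  have h0 : ∑ i ∈ Finset.range (e + 1), pRoot s i (b i) * x = 0 := by
    have h2 : ∑ i ∈ Finset.range (e + 1), pRoot s i (b i) = 0 := by simpa [adjF] using h1
    rw [← Finset.sum_mul, h2, zero_mul]
  have h3 : ∑ j ∈ Finset.range (e + 1), ∑ i ∈ Finset.range j,
      pRoot s i (b i) * x * (pRoot s j (b j) * x) = x * (gammaF s e b * x) := by
    simp only [gammaF, Finset.sum_mul, Finset.mul_sum]
    refine Finset.sum_congr rfl fun i _ => Finset.sum_congr rfl fun j _ => ?_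
    ring
  rw [h0, h3, Q_zero, one_mul, Finset.prod_congr rfl (fun i _ => hQ i), hF, ← eval_polyF,
    ← hR] at hγ
  rw [mul_add, psi_add, ← hγ, mul_left_comm, psi_mul_self, mul_one]

theorem psi_mul_polyRF_add_sq {b : ℕ → K} (h1 : adjF s e K b 1 = 0) (c x : K) :
    psi ξ (x * ((polyRF s e b).eval x + (gammaF s e b + c ^ 2) * x)) =
      Q ξ ((polyF s e b).eval x) * psi ξ (c * x) := by
  rw [← psi_mul_polyRF ξ s e h1, ← psi_sq ξ (c * x), ← psi_add]
  congr 1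
  ring

/-- Write `v = F(x)` over the algebraic closure. Then `E(x) = F^*(v) = 0`, so `x` lies in `V`, hence
in `K`, and adjointness moves `F` onto `w`. -/
theorem psi_mul_eq_one_of_adjF_eq_zero (hs : 1 ≤ s) {b : ℕ → K} (hF : IsAdmissible s e b)
    (hV : kerE s e (coeffRF s e b) ⊆ Set.range (algebraMap K (AlgebraicClosure K)))
    {v w : K} (hv : adjF s e K b v = 0) (hw : adjF s e K b w = 0) : psi ξ (v * w) = 1 := by
  obtain ⟨x, hx⟩ := exists_aeval_polyF_eq s e (AlgebraicClosure K) hs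
    (right_ne_zero_of_mul hF.coeff_ne_zero) (algebraMap K _ v)
  obtain ⟨x, rfl⟩ := hV (show x ∈ kerE s e (coeffRF s e b) by
    rw [kerE, Set.mem_ofPred_eq, ← adjF_aeval_polyF s e _ hF.adj_one, hx, ← algebraMap_adjF, hv,
      map_zero])
  rw [Polynomial.aeval_algebraMap_apply] at hx
  rw [← (algebraMap K (AlgebraicClosure K)).injective hx, Polynomial.coe_aeval_eq_eval,
    psi_polyF_mul, hw, mul_zero, psi_zero]

variable [CharZero C]

theorem numPoints_eq (hξ : Function.Injective ξ) (hs : s ∣ Module.finrank (ZMod 2) K)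
    (a : ℕ → K) (c : K) : (numPoints s (polyR s e a) c : C) = Fintype.card K +
      (2 ^ s - 1) * ∑ x, psi ξ (x * ((polyR s e a).eval x + c * x)) := by
  classical
  set f : K → K := fun x => x * ((polyR s e a).eval x + c * x) with hf
  have hadj : ∀ x y : K, psi ξ ((x ^ 2 ^ s - x) * y) = psi ξ (x * (pRoot s 1 y - y)) := by
    intro x y
    have h := psi_pRoot ξ s 1 (x ^ 2 ^ s * y)
    have h' := pRoot_pow_self s 1 x
    rw [pow_one] at h'
    rw [pRoot_mul, h'] at h
    rw [CharTwo.sub_eq_add, CharTwo.sub_eq_add, add_mul, mul_add, psi_add, psi_add, h]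
  have hfix : ∀ d : K, pRoot s 1 d - d = 0 ↔ d ^ 2 ^ s = d := fun d => by
    rw [sub_eq_zero, pRoot_eq_iff, mul_one, eq_comm]
  have h1 : numPoints s (polyR s e a) c =
      ∑ x : K, (Finset.univ.filter fun y => y ^ 2 ^ s - y = f x).card := by
    rw [numPoints, Nat.card_eq_fintype_card, Fintype.card_subtype, Finset.card_filter,
      Fintype.sum_prod_type]
    simp only [Finset.card_filter, hf]
  -- Write `d = r²` with `r ∈ 𝔽_p`. As `R` is `𝔽_p`-linear, `d * f x = f (r * x)`, so all nontrivial
  -- `d` contribute equally.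
  have h2 : ∀ d ∈ (Finset.univ.filter fun d : K => d ^ 2 ^ s = d).erase 0,
      ∑ x, psi ξ (d * f x) = ∑ x, psi ξ (f x) := by
    intro d hd
    obtain ⟨hd0, hd⟩ := Finset.mem_erase.mp hd
    replace hd := (Finset.mem_filter.mp hd).2
    obtain ⟨r, rfl⟩ : ∃ r : K, r ^ 2 = d := ⟨pRoot 1 1 d, pRoot_pow 1 1 d⟩
    have hr0 : r ≠ 0 := fun h => hd0 (by simp [h])
    have hr : r ^ 2 ^ s = r := by
      apply frobenius_inj K 2
      rwa [frobenius_def, frobenius_def, ← pow_mul, mul_comm, pow_mul]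
    have hri : ∀ i, r ^ (2 ^ s) ^ i = r := by
      intro i
      induction i with
      | zero => simp
      | succ i ih => rw [pow_succ, pow_mul, ih, hr]
    rw [← Equiv.sum_comp (Equiv.mulLeft₀ r hr0) (fun x => psi ξ (f x))]
    refine Finset.sum_congr rfl fun x _ => ?_
    change _ = psi ξ (f (r * x))
    congr 1
    simp only [hf, polyR, Polynomial.eval_finsetSum, Polynomial.eval_mul,
      Polynomial.eval_C, Polynomial.eval_pow, Polynomial.eval_X, mul_pow, hri]
    simp_rw [mul_left_comm _ r, ← Finset.mul_sum]
    ring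
  have h0 : (0 : K) ∈ Finset.univ.filter fun d : K => d ^ 2 ^ s = d := by simp
  rw [h1, Nat.cast_sum]
  simp_rw [card_fiber_eq_sum_psi ξ hξ hadj, hfix]
  rw [Finset.sum_comm, ← Finset.add_sum_erase _ _ h0, Finset.sum_congr rfl h2, Finset.sum_const,
    Finset.card_erase_of_mem h0, card_pow_two_pow_eq_self hs, nsmul_eq_mul,
    Nat.cast_sub Nat.one_le_two_pow]
  simp [hf]

theorem sum_psi_alphaF [DecidableEq K] (hξ : Function.Injective ξ) (hs : 1 ≤ s) {b : ℕ → K}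
    (hF : IsAdmissible s e b)
    (hV : kerE s e (coeffRF s e b) ⊆ Set.range (algebraMap K (AlgebraicClosure K)))
    (h1 : adjF s e K b 1 = 0) (t : K) [Decidable (t ∈ SF s e ξ b)] :
    (∑ x, psi ξ (x * ((polyRF s e b).eval x + alphaF s e b t * x))) * Q ξ t =
      (∑ x : K, Q ξ x) * if t ∈ SF s e ξ b then (2 ^ s) ^ e else 0 := by
  set W : Finset K := Finset.univ.filter fun v : K => adjF s e K b v = 0 with hW
  -- Completing the square by the translation `y ↦ y + c`.
  have hQ : ∀ c : K, (∑ y, Q ξ y * psi ξ (c * y)) * Q ξ c = ∑ y : K, Q ξ y := by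
    intro c
    rw [← Equiv.sum_comp (Equiv.addRight c) (Q ξ), Finset.sum_mul]
    refine Finset.sum_congr rfl fun y _ => ?_
    rw [mul_right_comm, Q_mul_Q, mul_comm y c, mul_assoc, psi_mul_self, mul_one]
    rfl
  have hQ2 : ∀ c : K, (∑ y, Q ξ y * psi ξ (c * y)) = (∑ y : K, Q ξ y) * (Q ξ c * psi ξ c) := by
    intro c
    rw [← hQ c, mul_assoc, ← mul_assoc (Q ξ c), Q_mul_self, psi_mul_self, mul_one]
  have hsum : ∑ x, psi ξ (x * ((polyRF s e b).eval x + alphaF s e b t * x)) =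
      ∑ x, Q ξ ((polyF s e b).eval x) * psi ξ (t * (polyF s e b).eval x) := by
    refine Finset.sum_congr rfl fun x _ => ?_
    rw [alphaF, psi_mul_polyRF_add_sq ξ s e h1, mul_comm t, psi_polyF_mul, mul_comm x]
  have hmem : t ∈ SF s e ξ b ↔ ∀ v ∈ W, Q ξ v = psi ξ (t * v) := by
    have : ∀ v : K, algebraMap K (AlgebraicClosure K) v ∈ kerAdjF s e b ↔ adjF s e K b v = 0 := by
      intro v
      rw [kerAdjF, Set.mem_ofPred_eq, ← algebraMap_adjF, map_eq_zero]
    simp [SF, this, hW]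
  -- Isotropy of `W` makes `g` multiplicative on `W`; it is trivial there exactly when `t ∈ S_F`.
  set g : K → C := fun v => Q ξ v * psi ξ (t * v) with hg
  have hgmul : ∀ v ∈ W, ∀ w ∈ W, g v * g w = g (v + w) := by
    intro v hv w hw
    have h2 := Q_mul_Q ξ v w
    rw [psi_mul_eq_one_of_adjF_eq_zero ξ s e hs hF hV (Finset.mem_filter.mp hv).2
      (Finset.mem_filter.mp hw).2, mul_one] at h2
    simp only [hg]
    rw [← h2, mul_add, psi_add]
    ring
  have hadd : ∀ v ∈ W, ∀ w ∈ W, v + w ∈ W := by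
    intro v hv w hw
    simp only [hW, Finset.mem_filter, Finset.mem_univ, true_and] at hv hw ⊢
    simp only [adjF, mul_add, pRoot_add, Finset.sum_add_distrib] at hv hw ⊢
    rw [hv, hw, add_zero]
  have hgone : ∀ v ∈ W, g v = 1 ↔ Q ξ v = psi ξ (t * v) := by
    intro v _
    have h2 := psi_mul_self ξ (t * v)
    constructor
    · intro h
      rw [← mul_one (Q ξ v), ← h2, ← mul_assoc]
      simp only [hg] at h
      rw [h, one_mul]
    · intro h
      simp only [hg]
      rw [h, h2]
  have hgsum : ∑ v ∈ W, g v = if t ∈ SF s e ξ b then (2 ^ s) ^ e else 0 := by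
    split_ifs with ht
    · rw [Finset.sum_congr rfl (fun v hv => (hgone v hv).mpr (hmem.mp ht v hv)), Finset.sum_const,
        hW, card_ker_adjF s e hs hF]
      simp
    · rw [hmem] at ht
      push Not at ht
      obtain ⟨w, hw, hne⟩ := ht
      rw [Ne, ← hgone w hw] at hne
      have h2 : g w * ∑ v ∈ W, g v = ∑ v ∈ W, g v := by
        rw [Finset.mul_sum]
        refine Finset.sum_bij' (fun v _ => w + v) (fun v _ => w + v) (fun v hv => hadd w hw v hv)
          (fun v hv => hadd w hw v hv) ?_ ?_ (fun v hv => hgmul w hw v hv)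
        all_goals
          intro v _
          rw [← add_assoc, CharTwo.add_self_eq_zero, zero_add]
      by_contra h3
      exact hne (mul_right_cancel₀ h3 (h2.trans (one_mul _).symm))
  -- Isotropy paired with `1 ∈ W`.
  have hone : ∀ v ∈ W, psi ξ v = 1 := by
    intro v hv
    have := psi_mul_eq_one_of_adjF_eq_zero ξ s e hs hF hV (Finset.mem_filter.mp hv).2 h1
    rwa [mul_one] at this
  rw [hsum, sum_comp_eq_sum_psi ξ hξ (psi_polyF_mul ξ s e b)
    (fun y => Q ξ y * psi ξ (t * y)), ← hgsum, Finset.sum_mul, Finset.mul_sum]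
  refine Finset.sum_congr rfl fun v hv => ?_
  have h3 : ∑ y, Q ξ y * psi ξ (t * y) * psi ξ (v * y) = ∑ y, Q ξ y * psi ξ ((t + v) * y) := by
    simp_rw [add_mul, psi_add, mul_assoc]
  have h4 := Q_mul_Q ξ t v
  rw [h3, hQ2, psi_add, hone v hv, mul_one, mul_assoc]
  congr 1
  have h5 : Q ξ (t + v) = Q ξ t * Q ξ v * psi ξ (t * v) := by
    rw [h4, mul_assoc, psi_mul_self, mul_one]
  rw [h5]
  simp only [hg]
  linear_combination (psi ξ t * Q ξ v * psi ξ (t * v)) * Q_mul_self ξ t +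
    (Q ξ v * psi ξ (t * v)) * psi_mul_self ξ t

theorem exists_alphaF_eq [DecidableEq K] (hξ : Function.Injective ξ) {b : ℕ → K}
    (h1 : adjF s e K b 1 = 0) {a : K}
    (ha : ∑ x, psi ξ (x * ((polyRF s e b).eval x + a * x)) ≠ 0) : ∃ t, alphaF s e b t = a := by
  obtain ⟨c, rfl⟩ : ∃ c : K, gammaF s e b + c ^ 2 = a := by
    refine ⟨pRoot 1 1 (a - gammaF s e b), ?_⟩
    rw [show (pRoot 1 1 (a - gammaF s e b)) ^ 2 = _ from pRoot_pow 1 1 _, add_sub_cancel]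
  have hadd : ∀ x y : K, (polyF s e b).eval (x + y) =
      (polyF s e b).eval x + (polyF s e b).eval y := by
    intro x y
    simp only [eval_polyF, ← pow_mul, add_pow_char_pow, mul_add, Finset.sum_add_distrib]
  -- Translating `x` by `u ∈ ker F` multiplies the nonzero sum by `psi (u c)`. Thus `c` is
  -- orthogonal to `ker F`, and the fibre count then places it in the image of `F^*`.
  have hker : ∀ u : K, (polyF s e b).eval u = 0 → psi ξ (u * c) = 1 := by
    intro u hu
    by_contra hne
    apply ha
    simp_rw [psi_mul_polyRF_add_sq ξ s e h1]
    have h2 : psi ξ (u * c) * ∑ x, Q ξ ((polyF s e b).eval x) * psi ξ (c * x) =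
        ∑ x, Q ξ ((polyF s e b).eval x) * psi ξ (c * x) := by
      conv_rhs => rw [← Equiv.sum_comp (Equiv.addRight u)]
      rw [Finset.mul_sum]
      refine Finset.sum_congr rfl fun x _ => ?_
      rw [Equiv.coe_addRight, hadd, hu, add_zero, mul_add, psi_add, mul_comm c u]
      ring
    by_contra h3
    exact hne (mul_right_cancel₀ h3 (h2.trans (one_mul _).symm))
  have hcard := card_fiber_eq_sum_psi ξ hξ (L := adjF s e K b)
    (L' := fun x => (polyF s e b).eval x) (fun x y => by
      rw [mul_comm, ← psi_polyF_mul, mul_comm]) c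
  rw [Finset.sum_congr rfl (fun u hu => hker u (Finset.mem_filter.mp hu).2), Finset.sum_const,
    nsmul_eq_mul, mul_one] at hcard
  have hne : (Finset.univ.filter fun x => adjF s e K b x = c).card ≠ 0 := by
    rw [Nat.cast_injective hcard]
    refine Finset.card_ne_zero.mpr ⟨0, ?_⟩
    simp [eval_polyF]
  obtain ⟨t, ht⟩ := Finset.card_ne_zero.mp hne
  exact ⟨t, by rw [alphaF, (Finset.mem_filter.mp ht).2]⟩

end ExponentialSums

end VanDerGeerVlugt

/-! ### The main theorem -/

open VanDerGeerVlugt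

theorem theorem5p11
    -- a prime `ℓ ≠ 2` and a faithful character `ξ₂` of `W₂(𝔽₂)`; `√-1` is `ξ₂(1, 0)`
    (ℓ : ℕ) [Fact ℓ.Prime] (hℓ : ℓ ≠ 2)
    (ξ : AddChar (W2 (ZMod 2)) (AlgebraicClosure ℚ_[ℓ])) (hξ : Function.Injective ξ)
    -- `p = 2 ^ s` and `K = 𝔽_q` with `q = p ^ n`
    (s : ℕ) (hs : 1 ≤ s) (n : ℕ)
    {K : Type*} [Field K] [Finite K] [CharP K 2] [Algebra (ZMod 2) K]
    (hK : Nat.card K = (2 ^ s) ^ n)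
    -- `R = ∑_{1 ≤ i ≤ e} aᵢ x^(p^i)` with `V = ker (R + R^*) ⊆ 𝔽_q`
    (e : ℕ) (he : 1 ≤ e) (a : ℕ → K) (ha : a e ≠ 0)
    (hV : kerE s e a ⊆ Set.range (algebraMap K (AlgebraicClosure K)))
    -- `F = ∑_{0 ≤ i ≤ e} bᵢ τ^i` with `R = R_F`
    (b : ℕ → K) (hF : IsAdmissible s e b) (hR : polyR s e a = polyRF s e b) :
    Even (Module.finrank (ZMod 2) K) ∧
    (S0 s e ξ b ∪ Sminus s e ξ b ∪ Splus s e ξ b = Set.univ ∧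
      Disjoint (S0 s e ξ b) (Sminus s e ξ b) ∧
      Disjoint (S0 s e ξ b) (Splus s e ξ b) ∧
      Disjoint (Sminus s e ξ b) (Splus s e ξ b)) ∧
    alphaF s e b '' S0 s e ξ b ⊆ T0 s (polyR s e a) ∧
    alphaF s e b '' Sminus s e ξ b = Tmax s e (polyR s e a) ∧
    alphaF s e b '' Splus s e ξ b = Tmin s e (polyR s e a) := by
  classical
  have := Fintype.ofFinite K
  have hRF : polyR s e a = polyR s e (coeffRF s e b) := hR
  have hV' : kerE s e (coeffRF s e b) ⊆ Set.range (algebraMap K (AlgebraicClosure K)) := by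
    intro x hx
    apply hV
    rw [kerE, Set.mem_ofPred_eq] at hx ⊢
    rw [mapE_congr s e _ hs hRF, hx]
  have h1 : adjF s e K b 1 = 0 := by
    apply (algebraMap K (AlgebraicClosure K)).injective
    rw [algebraMap_adjF, map_one, hF.adj_one, map_zero]
  have hi2 : ξ (W2.pair 1 0) * ξ (W2.pair 1 0) = -1 := by
    rw [← psi_one_pair ξ hξ, ← AddChar.map_add_eq_mul, W2.pair_add_pair, CharTwo.add_self_eq_zero]
    simp
  -- the kernel of `F^*` is isotropic and contains `1`
  have hpsi1 : psi ξ (1 : K) = 1 := by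
    simpa using psi_mul_eq_one_of_adjF_eq_zero ξ s e hs hF hV' h1 h1
  -- Here `1 = psi 1 = Q 1 ^ 2 = (-1) ^ [K : 𝔽₂]`.
  have heven : Even (Module.finrank (ZMod 2) K) := by
    have h2 := Q_mul_self ξ (1 : K)
    rw [hpsi1, Q_one, ← mul_pow, hi2] at h2
    by_contra hodd
    rw [Nat.not_even_iff_odd] at hodd
    rw [hodd.neg_one_pow] at h2
    norm_num at h2
  refine ⟨heven, ?_⟩
  obtain ⟨k, hk⟩ := heven.two_dvd
  have hk2 : Module.finrank (ZMod 2) K / 2 = k := by omega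
  set I := ξ (W2.pair 1 0) with hI
  have hI0 : I ^ k ≠ 0 := pow_ne_zero _
    (left_ne_zero_of_mul (a := I) (b := I) (by rw [hi2]; norm_num))
  have hcard : Nat.card K = 2 ^ k * 2 ^ k := by
    rw [Nat.card_eq_fintype_card, Module.card_eq_pow_finrank (K := ZMod 2) (V := K), ZMod.card, hk,
      two_mul, pow_add]
  have hsdvd : s ∣ Module.finrank (ZMod 2) K := by
    rw [Nat.card_eq_fintype_card, Module.card_eq_pow_finrank (K := ZMod 2) (V := K), ZMod.card,
      ← pow_mul] at hK
    exact ⟨n, Nat.pow_right_injective le_rfl hK⟩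
  have hsqrt : Real.sqrt (Nat.card K) = 2 ^ k := by
    rw [hcard]
    push_cast
    exact Real.sqrt_mul_self (by positivity)
  -- Testing `S_F` at `v = 1` gives `Q t ^ 2 = psi t = Q 1 = I ^ (2 * k)`.
  have hSQ : ∀ t ∈ SF s e ξ b, Q ξ t = -I ^ k ∨ Q ξ t = I ^ k := by
    intro t ht
    have h2 : Q ξ (1 : K) = psi ξ (t * 1) := ht 1 (by
      rw [kerAdjF, Set.mem_ofPred_eq, map_one, hF.adj_one])
    rw [mul_one, ← Q_mul_self, Q_one, hk, two_mul, pow_add] at h2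
    exact (mul_self_eq_mul_self_iff.mp h2.symm).symm
  set S : K → AlgebraicClosure ℚ_[ℓ] :=
    fun c => ∑ x, psi ξ (x * ((polyRF s e b).eval x + c * x)) with hS
  have hN : ∀ c, (numPoints s (polyR s e a) c : AlgebraicClosure ℚ_[ℓ]) =
      2 ^ k * 2 ^ k + (2 ^ s - 1) * S c := by
    intro c
    rw [numPoints_eq ξ s e hξ hsdvd, hS, hR, ← Nat.card_eq_fintype_card, hcard]
    push_cast
    rfl
  have hsum := fun t => sum_psi_alphaF ξ s e hξ hs hF hV' h1 t
  rw [sum_Q ξ hξ hk] at hsum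
  have hS0 : ∀ t ∈ S0 s e ξ b, S (alphaF s e b t) = 0 := by
    intro t ht
    have h2 := hsum t
    rw [if_neg ht, mul_zero] at h2
    have hQ0 : Q ξ t ≠ 0 := by
      intro h0
      have h3 := Q_mul_self ξ t
      have h4 := psi_mul_self ξ t
      rw [← h3, h0] at h4
      norm_num at h4
    exact (mul_eq_zero.mp h2).resolve_right hQ0
  have hSm : ∀ t ∈ Sminus s e ξ b, S (alphaF s e b t) = (2 ^ s) ^ e * 2 ^ k := by
    rintro t ⟨ht, hQt⟩
    have h2 := hsum t
    rw [if_pos ht, hQt, hk2] at h2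
    apply mul_right_cancel₀ (neg_ne_zero.mpr hI0)
    rw [h2]
    ring
  have hSp : ∀ t ∈ Splus s e ξ b, S (alphaF s e b t) = -((2 ^ s) ^ e * 2 ^ k) := by
    rintro t ⟨ht, hQt⟩
    have h2 := hsum t
    rw [if_pos ht, hQt, hk2] at h2
    apply mul_right_cancel₀ hI0
    rw [h2]
    ring
  have hs2 : (2 ^ s - 1 : ℤ) ≠ 0 := by
    have : (1 : ℤ) < 2 ^ s := one_lt_pow₀ (by norm_num) (by omega)
    omega
  -- Integers mediate between `S`, valued in the `ℓ`-adic closure, and the real-valued definitions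
  -- of `Tmax` and `Tmin`.
  have hNZ : ∀ (c : K) (z : ℤ), S c = z ↔
      (numPoints s (polyR s e a) c : ℤ) = 2 ^ k * 2 ^ k + (2 ^ s - 1) * z := by
    intro c z
    have hs3 : (2 ^ s - 1 : AlgebraicClosure ℚ_[ℓ]) ≠ 0 := by exact_mod_cast hs2
    constructor
    · intro h
      have h2 := hN c
      rw [h] at h2
      exact_mod_cast h2
    · intro h
      have h2 := hN c
      have h3 : (numPoints s (polyR s e a) c : AlgebraicClosure ℚ_[ℓ]) =
          2 ^ k * 2 ^ k + (2 ^ s - 1) * z := by exact_mod_cast h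
      rw [h2] at h3
      exact mul_left_cancel₀ hs3 (add_left_cancel h3)
  have hT0 : ∀ c, c ∈ T0 s (polyR s e a) ↔ S c = 0 := by
    intro c
    have h2 := hNZ c 0
    rw [Int.cast_zero] at h2
    rw [h2, T0, Set.mem_ofPred_eq, hcard, mul_zero, add_zero]
    norm_cast
  have hTmax : ∀ c, c ∈ Tmax s e (polyR s e a) ↔ S c = (2 ^ s) ^ e * 2 ^ k := by
    intro c
    have h2 := hNZ c ((2 ^ s) ^ e * 2 ^ k)
    push_cast at h2
    rw [h2, Tmax, Set.mem_ofPred_eq, hsqrt, hcard, ← @Int.cast_inj ℝ]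
    push_cast
    rw [mul_assoc]
  have hTmin : ∀ c, c ∈ Tmin s e (polyR s e a) ↔ S c = -((2 ^ s) ^ e * 2 ^ k) := by
    intro c
    have h2 := hNZ c (-((2 ^ s) ^ e * 2 ^ k))
    push_cast at h2
    rw [h2, Tmin, Set.mem_ofPred_eq, hsqrt, hcard, ← @Int.cast_inj ℝ]
    push_cast
    rw [mul_neg, ← sub_eq_add_neg, mul_assoc]
  have hcov : ∀ t, t ∈ S0 s e ξ b ∨ t ∈ Sminus s e ξ b ∨ t ∈ Splus s e ξ b := by
    intro t
    by_cases ht : t ∈ SF s e ξ b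
    · rcases hSQ t ht with h | h
      · exact Or.inr (Or.inl ⟨ht, by rw [h, hk2]⟩)
      · exact Or.inr (Or.inr ⟨ht, by rw [h, hk2]⟩)
    · exact Or.inl ht
  have hd : ((2 ^ s) ^ e * 2 ^ k : AlgebraicClosure ℚ_[ℓ]) ≠ 0 := by simp
  have hd2 : ((2 ^ s) ^ e * 2 ^ k : AlgebraicClosure ℚ_[ℓ]) ≠ -((2 ^ s) ^ e * 2 ^ k) :=
    fun h => hd (self_eq_neg.mp h)
  refine ⟨⟨?_, ?_, ?_, ?_⟩, ?_, ?_, ?_⟩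
  · ext t
    simpa [or_assoc] using hcov t
  · exact Set.disjoint_left.mpr fun t h0 h => h0 h.1
  · exact Set.disjoint_left.mpr fun t h0 h => h0 h.1
  -- A common element would give `S` two opposite nonzero values.
  · refine Set.disjoint_left.mpr fun t h h' => ?_
    exact hd2 ((hSm t h).symm.trans (hSp t h'))
  · rintro _ ⟨t, ht, rfl⟩
    exact (hT0 _).mpr (hS0 t ht)
  · ext c
    rw [hTmax]
    refine ⟨?_, fun hc => ?_⟩
    · rintro ⟨t, ht, rfl⟩
      exact hSm t ht
    · obtain ⟨t, rfl⟩ := exists_alphaF_eq ξ s e hξ h1 (a := c) (hc.trans_ne hd)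
      rcases hcov t with ht | ht | ht
      · exact absurd (hc.symm.trans (hS0 t ht)) hd
      · exact ⟨t, ht, rfl⟩
      · exact absurd (hc.symm.trans (hSp t ht)) hd2
  · ext c
    rw [hTmin]
    refine ⟨?_, fun hc => ?_⟩
    · rintro ⟨t, ht, rfl⟩
      exact hSp t ht
    · obtain ⟨t, rfl⟩ := exists_alphaF_eq ξ s e hξ h1 (a := c) (hc.trans_ne (neg_ne_zero.mpr hd))
      rcases hcov t with ht | ht | ht
      · exact absurd (hc.symm.trans (hS0 t ht)) (neg_ne_zero.mpr hd)
      · exact absurd ((hSm t ht).symm.trans hc) hd2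
      · exact ⟨t, ht, rfl⟩
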